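/- Let $m\ge 1$ be an integer and let $(X_1,X_2,X_3)$ be a real-valued, centered, jointly Gaussian random vector each of whose components is non-degenerate, i.e. $\mathrm{Var}(X_j)>0$ for $j=1,2,3$ (the covariance matrix of the vector may be singular). Then $$E\left[X_1^{2m}X_2^{6}X_3^{4}\right]\ \ge\ E\left[X_1^{2m}\right]\,E\left[X_2^{6}\right]\,E\left[X_3^{4}\right],$$ and equality holds if and only if $X_1,X_2,X_3$ are (mutually) independent. -/

import Mathlib

/-!
The inequality holds for all even exponents, and the proof is an induction that lowers one exponent
by two at a time. A centered Gaussian vector `X` has the law of `(⟨a i, g⟩)_i` with `g` standard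
Gaussian (`ProbabilityTheory.HasGaussianLaw.exists_map_eq`). After scaling, it suffices to bound
`M(p, q, r) = E[⟨u, g⟩ ^ p ⟨v, g⟩ ^ q ⟨w, g⟩ ^ r]` from below over unit vectors `u, v, w`
(`gaussMoment`). By compactness there is a minimizer. Stein's identity gives
`p M(p, q, r) = p (p - 1) M(p - 2, q, r) + l`, with `l = α ⟨u, v⟩ + β ⟨u, w⟩`,
`α = p q M(p - 1, q - 1, r)` and `β = p r M(p - 1, q, r - 1)`, so everything rests on `0 ≤ l` at a
minimizer (`multiplier_nonneg`).

The first-order conditions in `u` and `v` read `l u = α v + β w` and `l' v = α u + γ w`, with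
`γ = q r M(p, q - 1, r - 1)` (`lagrange`). If `l < 0`, eliminating `u` gives
`(α β + l γ) w = (l l' - α ^ 2) v`.
* If `α β + l γ ≠ 0`, the three vectors are collinear, and then `l` is a sum of moments with even
  exponents, hence nonnegative.
* If `α β + l γ = 0`, multiplying `l ⟨u, g⟩ = α ⟨v, g⟩ + β ⟨w, g⟩` by
  `⟨u, g⟩ ^ (p - 1) ⟨v, g⟩ ^ (q - 1) ⟨w, g⟩ ^ (r - 1)` and taking expectations gives
  `p l γ = (q + r) α β`. Together these force `α β = 0`, so `u` is parallel to `v` or to `w`, and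
  again `l ≥ 0`.

For equality, a triple of vectors attaining the bound is a minimizer, so the same step shows that it
attains the bound for `(p - 2, q, r)` too (`IsMomentBound.eq_of_add_two`). Descending to exponents
`(2, 2, 0)`, where the moment is `1 + 2 ⟨u, v⟩ ^ 2`, shows that the vectors are orthogonal.
-/

open MeasureTheory ProbabilityTheory MvPolynomial Matrix

section

variable {ι : Type*} [Fintype ι]

/-! ### Gaussian expectations of polynomials -/

theorem integrable_pow_gaussianReal (n : ℕ) :
    Integrable (fun x : ℝ => x ^ n) (gaussianReal 0 1) := by
  have h := (memLp_id_gaussianReal (μ := 0) (v := 1) (n : NNReal)).integrable_norm_pow'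
  refine (integrable_norm_iff (by fun_prop)).1 ?_
  simpa using h

theorem hasDerivAt_gaussianPDFReal_std (x : ℝ) :
    HasDerivAt (gaussianPDFReal 0 1) (-(x * gaussianPDFReal 0 1 x)) x := by
  unfold gaussianPDFReal
  have h : HasDerivAt (fun x : ℝ => -(x - 0) ^ 2 / (2 * ((1 : NNReal) : ℝ))) (-x) x := by
    refine ((((hasDerivAt_id x).sub_const 0).pow 2).neg.div_const
      (2 * ((1 : NNReal) : ℝ))).congr_deriv ?_
    simp; ring
  refine (h.exp.const_mul ((Real.sqrt (2 * Real.pi * ((1 : NNReal) : ℝ)))⁻¹)).congr_deriv ?_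
  ring

theorem integral_pow_succ_gaussianReal (n : ℕ) :
    ∫ x : ℝ, x ^ (n + 1) ∂(gaussianReal 0 1) = n * ∫ x : ℝ, x ^ (n - 1) ∂(gaussianReal 0 1) := by
  have hint (k : ℕ) : Integrable (fun x : ℝ => gaussianPDFReal 0 1 x * x ^ k) := by
    have h := integrable_pow_gaussianReal k
    rw [gaussianReal_of_var_ne_zero _ one_ne_zero,
      integrable_withDensity_iff_integrable_smul' (measurable_gaussianPDF _ _)
        (by simp [gaussianPDF_lt_top])] at h
    simpa [toReal_gaussianPDF] using h
  have key := integral_mul_deriv_eq_deriv_mul_of_integrable (u := fun x : ℝ => x ^ n)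
    (v := gaussianPDFReal 0 1) (u' := fun x => n * x ^ (n - 1))
    (v' := fun x => -(x * gaussianPDFReal 0 1 x))
    (fun x _ => hasDerivAt_pow n x) (fun x _ => hasDerivAt_gaussianPDFReal_std x)
    (by convert (hint (n + 1)).neg using 1; ext x; simp; ring)
    (by convert (hint (n - 1)).const_mul (n : ℝ) using 1; ext x; simp; ring)
    (by convert hint n using 1; ext x; simp; ring)
  rw [integral_gaussianReal_eq_integral_smul one_ne_zero,
    integral_gaussianReal_eq_integral_smul one_ne_zero, ← integral_const_mul]
  have e1 : ∫ x : ℝ, x ^ n * -(x * gaussianPDFReal 0 1 x) =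
      -∫ x : ℝ, gaussianPDFReal 0 1 x • x ^ (n + 1) := by
    rw [← integral_neg]; congr 1; ext x; simp; ring
  rw [e1, neg_inj] at key
  rw [key]; congr 1; ext x; simp; ring


theorem integrable_eval_gaussian (P : MvPolynomial ι ℝ) :
    Integrable (fun x => eval x P) (Measure.pi fun _ : ι => gaussianReal 0 1) := by
  induction P using MvPolynomial.induction_on' with
  | monomial s a =>
    simp only [eval_monomial, Finsupp.prod_fintype _ _ (fun i => pow_zero _)]
    exact (Integrable.fintype_prod (f := fun i (x : ℝ) => x ^ s i)
      fun i => integrable_pow_gaussianReal _).const_mul a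
  | add p q hp hq => simp only [map_add]; exact hp.add hq

/-- Expectation of a polynomial in independent standard Gaussian variables indexed by `ι`. -/
noncomputable def gaussE : MvPolynomial ι ℝ →ₗ[ℝ] ℝ where
  toFun P := ∫ x, eval x P ∂(Measure.pi fun _ : ι => gaussianReal 0 1)
  map_add' P Q := by
    simp only [map_add]
    exact integral_add (integrable_eval_gaussian P) (integrable_eval_gaussian Q)
  map_smul' c P := by simp [integral_const_mul]

theorem gaussE_apply (P : MvPolynomial ι ℝ) :
    gaussE P = ∫ x, eval x P ∂(Measure.pi fun _ : ι => gaussianReal 0 1) := rfl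

theorem gaussE_monomial (s : ι →₀ ℕ) (a : ℝ) :
    gaussE (monomial s a) = a * ∏ i, ∫ x : ℝ, x ^ s i ∂(gaussianReal 0 1) := by
  simp only [gaussE_apply, eval_monomial, Finsupp.prod_fintype _ _ (fun i => pow_zero _)]
  rw [integral_const_mul, integral_fintype_prod_eq_prod (fun i (x : ℝ) => x ^ s i)]

theorem gaussE_one : gaussE (1 : MvPolynomial ι ℝ) = 1 := by simp [gaussE_apply]

theorem gaussE_nonneg {P : MvPolynomial ι ℝ} (hP : ∀ x, 0 ≤ eval x P) : 0 ≤ gaussE P :=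
  integral_nonneg hP

/-- Gaussian integration by parts (Stein's identity) for polynomials. -/
theorem gaussE_X_mul (i : ι) (P : MvPolynomial ι ℝ) : gaussE (X i * P) = gaussE (pderiv i P) := by
  classical
  induction P using MvPolynomial.induction_on' with
  | monomial s a =>
    rw [pderiv_monomial, X, monomial_mul, gaussE_monomial, gaussE_monomial,
      ← Finset.mul_prod_erase _ _ (Finset.mem_univ i),
      ← Finset.mul_prod_erase _ _ (Finset.mem_univ i)]
    have e : ∏ x ∈ Finset.univ.erase i,
          ∫ y : ℝ, y ^ (Finsupp.single i 1 + s : ι →₀ ℕ) x ∂(gaussianReal 0 1) =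
        ∏ x ∈ Finset.univ.erase i,
          ∫ y : ℝ, y ^ (s - Finsupp.single i 1 : ι →₀ ℕ) x ∂(gaussianReal 0 1) := by
      refine Finset.prod_congr rfl fun j hj => ?_
      simp [(Finset.ne_of_mem_erase hj).symm]
    have h := integral_pow_succ_gaussianReal (s i)
    rw [e]
    simp only [Finsupp.add_apply, Finsupp.single_eq_same, Finsupp.tsub_apply]
    rw [add_comm 1, h]
    ring
  | add p q hp hq => simp [mul_add, hp, hq]

/-- The linear form `x ↦ ∑ i, u i * x i`. -/
noncomputable def linForm (u : ι → ℝ) : MvPolynomial ι ℝ := ∑ i, C (u i) * X i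

theorem eval_linForm (u x : ι → ℝ) : eval x (linForm u) = u ⬝ᵥ x := by
  simp [linForm, dotProduct]

theorem linForm_add (u v : ι → ℝ) : linForm (u + v) = linForm u + linForm v := by
  simp [linForm, add_mul, Finset.sum_add_distrib]

theorem linForm_smul (c : ℝ) (u : ι → ℝ) : linForm (c • u) = C c * linForm u := by
  simp [linForm, Finset.mul_sum, mul_assoc]

theorem pderiv_linForm (i : ι) (u : ι → ℝ) : pderiv i (linForm u) = C (u i) := by
  classical
  simp [linForm, pderiv_X, Pi.single_apply]

/-- The mixed moment `E[⟨u, g⟩ ^ p * ⟨v, g⟩ ^ q * ⟨w, g⟩ ^ r]` of a standard Gaussian vector `g`. -/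
noncomputable def gaussMoment (p q r : ℕ) (u v w : ι → ℝ) : ℝ :=
  gaussE (linForm u ^ p * linForm v ^ q * linForm w ^ r)

theorem gaussMoment_swap₁₂ (p q r : ℕ) (u v w : ι → ℝ) :
    gaussMoment p q r u v w = gaussMoment q p r v u w := by
  unfold gaussMoment; congr 1; ring

theorem gaussMoment_swap₁₃ (p q r : ℕ) (u v w : ι → ℝ) :
    gaussMoment p q r u v w = gaussMoment r q p w v u := by
  unfold gaussMoment; congr 1; ring

theorem gaussMoment_swap₂₃ (p q r : ℕ) (u v w : ι → ℝ) :
    gaussMoment p q r u v w = gaussMoment p r q u w v := by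
  unfold gaussMoment; congr 1; ring

theorem gaussE_C_mul (c : ℝ) (P : MvPolynomial ι ℝ) : gaussE (C c * P) = c * gaussE P := by
  rw [C_mul', map_smul, smul_eq_mul]

/-- Stein's identity for a product of powers of linear forms. -/
theorem gaussE_linForm_mul (p q r : ℕ) (a u v w : ι → ℝ) :
    gaussE (linForm a * (linForm u ^ p * linForm v ^ q * linForm w ^ r)) =
      p * (a ⬝ᵥ u) * gaussMoment (p - 1) q r u v w + q * (a ⬝ᵥ v) * gaussMoment p (q - 1) r u v w +
        r * (a ⬝ᵥ w) * gaussMoment p q (r - 1) u v w := by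
  set P := linForm u ^ p * linForm v ^ q * linForm w ^ r with hP
  have hd (i : ι) : gaussE (pderiv i P) = p * u i * gaussMoment (p - 1) q r u v w +
      q * v i * gaussMoment p (q - 1) r u v w + r * w i * gaussMoment p q (r - 1) u v w := by
    have : pderiv i P = C (p * u i) * (linForm u ^ (p - 1) * linForm v ^ q * linForm w ^ r) +
        C (q * v i) * (linForm u ^ p * linForm v ^ (q - 1) * linForm w ^ r) +
        C (r * w i) * (linForm u ^ p * linForm v ^ q * linForm w ^ (r - 1)) := by
      simp only [hP, pderiv_mul, pderiv_pow, pderiv_linForm, map_mul, map_natCast]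
      ring
    rw [this, map_add, map_add, gaussE_C_mul, gaussE_C_mul, gaussE_C_mul]
    rfl
  rw [linForm, Finset.sum_mul, map_sum]
  simp only [mul_assoc (C _) (X _), gaussE_C_mul, gaussE_X_mul, hd, dotProduct,
    Finset.mul_sum, Finset.sum_mul, ← Finset.sum_add_distrib]
  exact Finset.sum_congr rfl fun i _ => by ring

theorem gaussMoment_succ (p q r : ℕ) (u v w : ι → ℝ) :
    gaussMoment (p + 1) q r u v w =
      p * (u ⬝ᵥ u) * gaussMoment (p - 1) q r u v w + q * (u ⬝ᵥ v) * gaussMoment p (q - 1) r u v w +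
        r * (u ⬝ᵥ w) * gaussMoment p q (r - 1) u v w := by
  rw [← gaussE_linForm_mul, gaussMoment]
  congr 1; ring

theorem gaussMoment_zero (u v w : ι → ℝ) : gaussMoment 0 0 0 u v w = 1 := by
  simp [gaussMoment, gaussE_one]

theorem gaussMoment_smul (p q r : ℕ) (c : ℝ) (u v w : ι → ℝ) :
    gaussMoment p q r (c • u) v w = c ^ p * gaussMoment p q r u v w := by
  rw [gaussMoment, gaussMoment, linForm_smul, mul_pow, ← map_pow, mul_assoc (C _), mul_assoc (C _),
    gaussE_C_mul]

theorem gaussMoment_eq_integral (p q r : ℕ) (u v w : ι → ℝ) :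
    gaussMoment p q r u v w = ∫ x, (u ⬝ᵥ x) ^ p * (v ⬝ᵥ x) ^ q * (w ⬝ᵥ x) ^ r
      ∂(Measure.pi fun _ : ι => gaussianReal 0 1) := by
  simp [gaussMoment, gaussE_apply, eval_linForm]

/-- The recursion `gaussMoment_succ` expresses the moment as a polynomial in the entries of the
vectors, which gives continuity without any domination argument. -/
theorem continuous_gaussMoment (p q r : ℕ) :
    Continuous fun x : (ι → ℝ) × (ι → ℝ) × (ι → ℝ) => gaussMoment p q r x.1 x.2.1 x.2.2 := by
  have hdot {f g : (ι → ℝ) × (ι → ℝ) × (ι → ℝ) → ι → ℝ} (hf : Continuous f) (hg : Continuous g) :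
      Continuous fun x => f x ⬝ᵥ g x := by
    unfold dotProduct; fun_prop
  induction hn : p + q + r using Nat.strong_induction_on generalizing p q r with
  | _ n ih =>
    subst hn
    have aux (p q r k : ℕ) (hk : p + q + r < k)
        (ih : ∀ m < k, ∀ p q r : ℕ, p + q + r = m →
          Continuous fun x : (ι → ℝ) × (ι → ℝ) × (ι → ℝ) => gaussMoment p q r x.1 x.2.1 x.2.2) :
        Continuous fun x : (ι → ℝ) × (ι → ℝ) × (ι → ℝ) =>
          gaussMoment (p + 1) q r x.1 x.2.1 x.2.2 := by
      simp only [gaussMoment_succ]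
      refine ((?_ : Continuous _).add ?_).add ?_
      · exact (continuous_const.mul (hdot (by fun_prop) (by fun_prop))).mul
          (ih _ (by omega) _ _ _ rfl)
      · exact (continuous_const.mul (hdot (by fun_prop) (by fun_prop))).mul
          (ih _ (by omega) _ _ _ rfl)
      · exact (continuous_const.mul (hdot (by fun_prop) (by fun_prop))).mul
          (ih _ (by omega) _ _ _ rfl)
    rcases p with _ | p
    · rcases q with _ | q
      · rcases r with _ | r
        · simp only [gaussMoment_zero]; exact continuous_const
        · have h := (aux r 0 0 (0 + 0 + (r + 1)) (by omega) fun m hm a b c h =>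
            ih m hm a b c h).comp
            (f := fun x : (ι → ℝ) × (ι → ℝ) × (ι → ℝ) => (x.2.2, x.2.1, x.1)) (by fun_prop)
          simp only [gaussMoment_swap₁₃ 0 0 (r + 1)]
          exact h
      · have h := (aux q 0 r (0 + (q + 1) + r) (by omega) fun m hm a b c h => ih m hm a b c h).comp
          (f := fun x : (ι → ℝ) × (ι → ℝ) × (ι → ℝ) => (x.2.1, x.1, x.2.2)) (by fun_prop)
        simp only [gaussMoment_swap₁₂ 0 (q + 1) r]
        exact h
    · exact aux p q r _ (by omega) fun m hm a b c h => ih m hm a b c h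

/-! ### Minimizers of the mixed moment on a product of spheres -/


/-- Derivative at `0` of `t ↦ E[⟨u + t • a, g⟩ ^ n * Q g]`. -/
theorem hasDerivAt_gaussE_linForm_pow (n : ℕ) (u a : ι → ℝ) (Q : MvPolynomial ι ℝ) :
    HasDerivAt (fun t : ℝ => gaussE (linForm (u + t • a) ^ n * Q))
      (n * gaussE (linForm a * linForm u ^ (n - 1) * Q)) 0 := by
  induction n generalizing Q with
  | zero => simpa using hasDerivAt_const (0 : ℝ) (gaussE Q)
  | succ n ih =>
    have e : (fun t : ℝ => gaussE (linForm (u + t • a) ^ (n + 1) * Q)) = fun t =>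
        gaussE (linForm (u + t • a) ^ n * (linForm u * Q)) +
          t * gaussE (linForm (u + t • a) ^ n * (linForm a * Q)) := by
      ext t
      rw [← gaussE_C_mul, ← map_add]
      congr 1
      rw [pow_succ, linForm_add, linForm_smul]; ring
    rw [e]
    refine ((ih (linForm u * Q)).add
      ((hasDerivAt_id (0 : ℝ)).mul (ih (linForm a * Q)))).congr_deriv ?_
    -- for `n = 0` the truncated exponent `n - 1` is harmless because of the factor `n`
    have h1 : linForm a * linForm u ^ (n - 1) * (linForm u * Q) = linForm a * linForm u ^ n * Q ∨
        n = 0 := by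
      rcases n with _ | n
      · simp
      · left; simp only [Nat.add_sub_cancel]; ring
    have h2 : (n : ℝ) * gaussE (linForm a * linForm u ^ (n - 1) * (linForm u * Q)) =
        n * gaussE (linForm a * linForm u ^ n * Q) := by
      rcases h1 with h | h
      · rw [h]
      · simp [h]
    have h3 : linForm u ^ n * (linForm a * Q) = linForm a * linForm u ^ n * Q := by ring
    rw [h2]
    simp [h3]
    ring

/-- `p * q` times the mixed moment with the first two exponents lowered by one, that is, the
derivative of the mixed moment with respect to the covariance `u ⬝ᵥ v`. It vanishes when `p` or `q`
is `0`, where the truncated subtraction would otherwise matter. -/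
noncomputable def crossMoment (p q r : ℕ) (u v w : ι → ℝ) : ℝ :=
  p * q * gaussMoment (p - 1) (q - 1) r u v w

theorem crossMoment_comm (p q r : ℕ) (u v w : ι → ℝ) :
    crossMoment p q r u v w = crossMoment q p r v u w := by
  rw [crossMoment, crossMoment, gaussMoment_swap₁₂]; ring

/-- First-order condition in `u`, tested against a tangent vector `a` of the sphere. By homogeneity,
minimality on the sphere gives a polynomial inequality along the line `u + t • a`, which is an
equality at `t = 0`. -/
theorem first_order_condition {p q r : ℕ} (hp : Even p) {u v w a : ι → ℝ} (hu : u ⬝ᵥ u = 1)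
    (hmin : ∀ u' : ι → ℝ, u' ⬝ᵥ u' = 1 → gaussMoment p q r u v w ≤ gaussMoment p q r u' v w)
    (ha : a ⬝ᵥ u = 0) :
    crossMoment p q r u v w * (a ⬝ᵥ v) + crossMoment p r q u w v * (a ⬝ᵥ w) = 0 := by
  obtain ⟨k, rfl⟩ := hp.exists_two_nsmul
  simp only [smul_eq_mul] at *
  set F := gaussMoment (2 * k) q r u v w with hF
  let h : ℝ → ℝ := fun t =>
    gaussE (linForm (u + t • a) ^ (2 * k) * (linForm v ^ q * linForm w ^ r)) -
    F * (1 + t ^ 2 * (a ⬝ᵥ a)) ^ k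
  have h0 : h 0 = 0 := by simp [h, hF, gaussMoment, mul_assoc]
  have hge (t : ℝ) : 0 ≤ h t := by
    have haa : 0 ≤ a ⬝ᵥ a := by simpa using dotProduct_star_self_nonneg a
    have hpos : 0 < 1 + t ^ 2 * (a ⬝ᵥ a) := by positivity
    -- `s` is the norm of `u + t • a`
    set s := Real.sqrt (1 + t ^ 2 * (a ⬝ᵥ a)) with hs
    have hspos : 0 < s := Real.sqrt_pos.2 hpos
    have hs2 : s ^ 2 = 1 + t ^ 2 * (a ⬝ᵥ a) := Real.sq_sqrt hpos.le
    have hnorm : (u + t • a) ⬝ᵥ (u + t • a) = s ^ 2 := by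
      rw [hs2]
      simp [add_dotProduct, dotProduct_add, hu, ha, dotProduct_comm u a]; ring
    have hm := hmin (s⁻¹ • (u + t • a)) (by
      rw [smul_dotProduct, dotProduct_smul, hnorm]; simp; field_simp)
    rw [gaussMoment_smul, inv_pow, le_inv_mul_iff₀ (by positivity), pow_mul, hs2] at hm
    have : h t = gaussMoment (2 * k) q r (u + t • a) v w - (1 + t ^ 2 * (a ⬝ᵥ a)) ^ k * F := by
      simp only [h, gaussMoment]; rw [mul_assoc]; ring
    rw [this]; linarith
  have hd : HasDerivAt h ((2 * k : ℕ) * gaussE (linForm a * linForm u ^ (2 * k - 1) *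
      (linForm v ^ q * linForm w ^ r)) - 0) 0 := by
    refine (hasDerivAt_gaussE_linForm_pow _ u a _).sub ?_
    have := ((((hasDerivAt_id (0 : ℝ)).pow 2).mul_const (a ⬝ᵥ a)).const_add 1).pow k |>.const_mul F
    refine this.congr_deriv ?_
    simp
  have hloc : IsLocalMin h 0 := Filter.Eventually.of_forall fun t => by rw [h0]; exact hge t
  have hz := hloc.hasDerivAt_eq_zero hd
  rw [sub_zero, mul_assoc, ← mul_assoc (linForm u ^ _), gaussE_linForm_mul, ha] at hz
  rw [crossMoment, crossMoment, gaussMoment_swap₂₃ _ (r - 1)]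
  linear_combination hz

/-- Lagrange multiplier form of the first-order condition. -/
theorem lagrange {p q r : ℕ} (hp : Even p) {u v w : ι → ℝ} (hu : u ⬝ᵥ u = 1)
    (hmin : ∀ u' : ι → ℝ, u' ⬝ᵥ u' = 1 → gaussMoment p q r u v w ≤ gaussMoment p q r u' v w) :
    (crossMoment p q r u v w * (u ⬝ᵥ v) + crossMoment p r q u w v * (u ⬝ᵥ w)) • u =
      crossMoment p q r u v w • v + crossMoment p r q u w v • w := by
  set α := crossMoment p q r u v w with hα
  set β := crossMoment p r q u w v with hβ
  -- the tangential part `z` of `α • v + β • w` is tested against itself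
  set z := α • v + β • w - (α * (u ⬝ᵥ v) + β * (u ⬝ᵥ w)) • u with hz
  have hzu : z ⬝ᵥ u = 0 := by
    simp only [hz, sub_dotProduct, add_dotProduct, smul_dotProduct, smul_eq_mul, hu,
      dotProduct_comm v u, dotProduct_comm w u]
    ring
  have h := first_order_condition hp hu hmin hzu
  have hzz : z ⬝ᵥ z = 0 := by
    nth_rewrite 2 [hz]
    simp only [dotProduct_sub, dotProduct_add, dotProduct_smul, smul_eq_mul, hzu]
    linear_combination h
  have : z = 0 := dotProduct_self_eq_zero.1 hzz
  exact (sub_eq_zero.1 (hz ▸ this)).symm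

/-- For `v = c • u` the product is a nonnegative multiple of `E[⟨u, g⟩ ^ (p + q - 2) * ⟨w, g⟩ ^ r]`,
whose exponents are even. -/
theorem crossMoment_mul_nonneg {p q r : ℕ} (hp : Even p) (hq : Even q) (hr : Even r)
    {u v w : ι → ℝ} {c : ℝ} (hu : u ⬝ᵥ u = 1) (hv : v = c • u) :
    0 ≤ crossMoment p q r u v w * (u ⬝ᵥ v) := by
  subst hv
  rcases p with _ | p
  · simp [crossMoment]
  rcases q with _ | q
  · simp [crossMoment]
  have e : crossMoment (p + 1) (q + 1) r u (c • u) w * (u ⬝ᵥ c • u) =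
      (p + 1) * (q + 1) * c ^ (q + 1) * gaussE (linForm u ^ (p + q) * linForm w ^ r) := by
    rw [crossMoment, gaussMoment_swap₁₂, gaussMoment_smul, dotProduct_smul, hu, gaussMoment]
    simp only [Nat.add_sub_cancel, smul_eq_mul, mul_one]
    rw [← pow_add, add_comm q p]
    push_cast
    ring
  rw [e]
  have hpq : Even (p + q) := by
    rw [Nat.even_add_one] at hp hq
    exact Nat.even_add.2 ⟨fun h => absurd h hp, fun h => absurd h hq⟩
  have := hq.pow_nonneg c
  have h2 : 0 ≤ gaussE (linForm u ^ (p + q) * linForm w ^ r) := gaussE_nonneg fun x => by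
    simp only [map_mul, map_pow]
    exact mul_nonneg (hpq.pow_nonneg _) (hr.pow_nonneg _)
  positivity

/-- Obtained from `l * ⟨u, g⟩ = α * ⟨v, g⟩ + β * ⟨w, g⟩` by multiplying by
`⟨u, g⟩ ^ (p - 1) * ⟨v, g⟩ ^ (q - 1) * ⟨w, g⟩ ^ (r - 1)` and taking expectations. -/
theorem crossMoment_relation {p q r : ℕ} {u v w : ι → ℝ} {l α β : ℝ} (hp : p ≠ 0) (hq : q ≠ 0)
    (hr : r ≠ 0) (h : l • u = α • v + β • w) :
    l * crossMoment q r p v w u * p =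
      α * crossMoment p r q u w v * q + β * crossMoment p q r u v w * r := by
  obtain ⟨p, rfl⟩ := Nat.exists_eq_succ_of_ne_zero hp
  obtain ⟨q, rfl⟩ := Nat.exists_eq_succ_of_ne_zero hq
  obtain ⟨r, rfl⟩ := Nat.exists_eq_succ_of_ne_zero hr
  have hl : C l * linForm u = C α * linForm v + C β * linForm w := by
    rw [← linForm_smul, h, linForm_add, linForm_smul, linForm_smul]
  have e := congrArg (fun P => gaussE (P * (linForm u ^ p * linForm v ^ q * linForm w ^ r))) hl
  simp only [add_mul, map_add, mul_assoc (C _), gaussE_C_mul] at e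
  have e1 : gaussE (linForm u * (linForm u ^ p * linForm v ^ q * linForm w ^ r)) =
      gaussMoment q r (p + 1) v w u := by unfold gaussMoment; congr 1; ring
  have e2 : gaussE (linForm v * (linForm u ^ p * linForm v ^ q * linForm w ^ r)) =
      gaussMoment p r (q + 1) u w v := by unfold gaussMoment; congr 1; ring
  have e3 : gaussE (linForm w * (linForm u ^ p * linForm v ^ q * linForm w ^ r)) =
      gaussMoment p q (r + 1) u v w := by unfold gaussMoment; congr 1; ring
  rw [e1, e2, e3] at e
  simp only [crossMoment, Nat.succ_eq_add_one, Nat.add_sub_cancel]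
  push_cast
  linear_combination ((p : ℝ) + 1) * (q + 1) * (r + 1) * e

/-- At a minimizer over the spheres the Lagrange multiplier is nonnegative. -/
theorem multiplier_nonneg {p q r : ℕ} (hp0 : p ≠ 0) (hp : Even p) (hq : Even q) (hr : Even r)
    {u v w : ι → ℝ} (hu : u ⬝ᵥ u = 1) (hv : v ⬝ᵥ v = 1)
    (hminu : ∀ u' : ι → ℝ, u' ⬝ᵥ u' = 1 → gaussMoment p q r u v w ≤ gaussMoment p q r u' v w)
    (hminv : ∀ v' : ι → ℝ, v' ⬝ᵥ v' = 1 → gaussMoment p q r u v w ≤ gaussMoment p q r u v' w) :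
    0 ≤ crossMoment p q r u v w * (u ⬝ᵥ v) + crossMoment p r q u w v * (u ⬝ᵥ w) := by
  have h1 := lagrange hp hu hminu
  have h2 := lagrange hq hv (u := v) (v := u) (w := w) (p := q) (q := p) (r := r) fun v' hv' => by
    rw [gaussMoment_swap₁₂ q p, gaussMoment_swap₁₂ q p]; exact hminv v' hv'
  have hr1 (hq0 : q ≠ 0) (hr0 : r ≠ 0) := crossMoment_relation hp0 hq0 hr0 h1
  rw [← crossMoment_comm p q r u v w] at h2
  have hα (c : ℝ) (h : v = c • u) : 0 ≤ crossMoment p q r u v w * (u ⬝ᵥ v) :=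
    crossMoment_mul_nonneg hp hq hr hu h
  have hβ (c : ℝ) (h : w = c • u) : 0 ≤ crossMoment p r q u w v * (u ⬝ᵥ w) :=
    crossMoment_mul_nonneg hp hr hq hu h
  have hα0 (h : q = 0) : crossMoment p q r u v w = 0 := by simp [crossMoment, h]
  have hβ0 (h : r = 0) : crossMoment p r q u w v = 0 := by simp [crossMoment, h]
  set α := crossMoment p q r u v w
  set β := crossMoment p r q u w v
  set γ := crossMoment q r p v w u
  set l := α * (u ⬝ᵥ v) + β * (u ⬝ᵥ w) with hl
  set l' := α * (v ⬝ᵥ u) + γ * (v ⬝ᵥ w)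
  by_contra! hneg
  have hu0 : u ≠ 0 := by rintro rfl; simp at hu
  have hl0 : l ≠ 0 := hneg.ne
  -- otherwise `u` is parallel to `w` or to `v`, and the only remaining term of `l` is nonnegative
  have hαβ : α * β ≠ 0 := by
    intro h0
    rcases mul_eq_zero.1 h0 with h | h
    · have hb : β ≠ 0 := by rintro hb; apply hl0; rw [hl, h, hb]; ring
      have : w = (β⁻¹ * l) • u := by rw [mul_smul, h1, h]; simp [smul_smul, hb]
      have := hβ _ this
      rw [hl, h] at hneg; linarith
    · have hb : α ≠ 0 := by rintro hb; apply hl0; rw [hl, h, hb]; ring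
      have : v = (α⁻¹ * l) • u := by rw [mul_smul, h1, h]; simp [smul_smul, hb]
      have := hα _ this
      rw [hl, h] at hneg; linarith
  -- eliminate `u` from the two first-order conditions
  have key : (α * β + l * γ) • w = (l * l' - α ^ 2) • v := by
    have : l • (l' • v) = α • (l • u) + (l * γ) • w := by
      rw [h2]; module
    rw [h1] at this
    linear_combination (norm := module) -this
  by_cases hκ : α * β + l * γ = 0
  · have hq0 : q ≠ 0 := fun h => hαβ (by rw [hα0 h, zero_mul])
    have hr0 : r ≠ 0 := fun h => hαβ (by rw [hβ0 h, mul_zero])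
    have h3 := hr1 hq0 hr0
    have h4 : α * β * (p + q + r) = 0 := by linear_combination (p : ℝ) * hκ - h3
    have : (0 : ℝ) < p + q + r := by
      have : (0 : ℝ) < p := by exact_mod_cast Nat.pos_of_ne_zero hp0
      positivity
    exact (mul_ne_zero hαβ this.ne') h4
  -- here all three vectors are collinear, and both terms of `l` are nonnegative
  · set c := (α * β + l * γ)⁻¹ * (l * l' - α ^ 2)
    have hw : w = c • v := by rw [mul_smul, ← key, smul_smul, inv_mul_cancel₀ hκ, one_smul]
    set d := l⁻¹ * (α + β * c)
    have hud : u = d • v := by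
      have : u = l⁻¹ • (l • u) := by rw [smul_smul, inv_mul_cancel₀ hl0, one_smul]
      rw [this, h1, hw]; module
    have hd : d ≠ 0 := by rintro h; apply hu0; rw [hud, h, zero_smul]
    have hvu : v = d⁻¹ • u := by
      conv_rhs => rw [hud, smul_smul, inv_mul_cancel₀ hd, one_smul]
    have hwu : w = (c * d⁻¹) • u := by rw [mul_smul, ← hvu, hw]
    have := hα _ hvu
    have := hβ _ hwu
    linarith

/-- At a minimizer the exponent can be lowered by two: the remaining terms of Stein's identity add
up to a positive multiple of the Lagrange multiplier. -/
theorem minimizer_step {p q r : ℕ} (hp : Even p) (hq : Even q) (hr : Even r)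
    {u v w : ι → ℝ} (hu : u ⬝ᵥ u = 1) (hv : v ⬝ᵥ v = 1)
    (hminu : ∀ u' : ι → ℝ, u' ⬝ᵥ u' = 1 →
      gaussMoment (p + 2) q r u v w ≤ gaussMoment (p + 2) q r u' v w)
    (hminv : ∀ v' : ι → ℝ, v' ⬝ᵥ v' = 1 →
      gaussMoment (p + 2) q r u v w ≤ gaussMoment (p + 2) q r u v' w) :
    (p + 1) * gaussMoment p q r u v w ≤ gaussMoment (p + 2) q r u v w := by
  have h := multiplier_nonneg (by omega) (hp.add even_two) hq hr hu hv hminu hminv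
  have e := gaussMoment_succ (p + 1) q r u v w
  rw [crossMoment, crossMoment, gaussMoment_swap₂₃ _ (r - 1)] at h
  simp only [show p + 2 - 1 = p + 1 by omega] at h
  rw [hu] at e
  simp only [Nat.add_sub_cancel, show p + 1 + 1 = p + 2 by omega] at e
  push_cast at h e
  have hp2 : (0 : ℝ) < p + 2 := by positivity
  rw [e]
  have : 0 ≤ (p + 2 : ℝ) * (q * (u ⬝ᵥ v) * gaussMoment (p + 1) (q - 1) r u v w +
      r * (u ⬝ᵥ w) * gaussMoment (p + 1) q (r - 1) u v w) := by linarith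
  have := nonneg_of_mul_nonneg_right this hp2
  linarith

theorem isCompact_dotProduct_self_eq_one : IsCompact {u : ι → ℝ | u ⬝ᵥ u = 1} := by
  refine Metric.isCompact_of_isClosed_isBounded ?_ ?_
  · exact isClosed_eq (by unfold dotProduct; fun_prop) continuous_const
  · refine (Metric.isBounded_closedBall (x := 0) (r := 1)).subset fun u (hu : u ⬝ᵥ u = 1) => ?_
    rw [mem_closedBall_zero_iff, pi_norm_le_iff_of_nonneg zero_le_one]
    intro i
    rw [Real.norm_eq_abs, ← sq_le_one_iff_abs_le_one, ← hu, dotProduct, sq]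
    exact Finset.single_le_sum (f := fun i => u i * u i) (fun j _ => mul_self_nonneg _)
      (Finset.mem_univ i)

/-! ### The bound for unit vectors and its equality case -/

/-- `C` is a lower bound of the mixed moments of exponents `p, q, r` over all unit vectors. -/
def IsMomentBound (ι : Type*) [Fintype ι] (p q r : ℕ) (C : ℝ) : Prop :=
  ∀ u v w : ι → ℝ, u ⬝ᵥ u = 1 → v ⬝ᵥ v = 1 → w ⬝ᵥ w = 1 → C ≤ gaussMoment p q r u v w

theorem IsMomentBound.add_two {p q r : ℕ} {C : ℝ} (hp : Even p) (hq : Even q) (hr : Even r)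
    (h : IsMomentBound ι p q r C) : IsMomentBound ι (p + 2) q r ((p + 1) * C) := by
  intro u v w hu hv hw
  have hc := (isCompact_dotProduct_self_eq_one (ι := ι)).prod
    ((isCompact_dotProduct_self_eq_one (ι := ι)).prod (isCompact_dotProduct_self_eq_one (ι := ι)))
  obtain ⟨⟨a, b, c⟩, ⟨ha, hb, hc⟩, hmin⟩ := hc.exists_isMinOn ⟨(u, v, w), hu, hv, hw⟩
    (continuous_gaussMoment (p + 2) q r).continuousOn
  have ha : a ⬝ᵥ a = 1 := ha
  have hb : b ⬝ᵥ b = 1 := hb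
  have hc : c ⬝ᵥ c = 1 := hc
  have hmin (x y z : ι → ℝ) (hx : x ⬝ᵥ x = 1) (hy : y ⬝ᵥ y = 1) (hz : z ⬝ᵥ z = 1) :
      gaussMoment (p + 2) q r a b c ≤ gaussMoment (p + 2) q r x y z :=
    hmin (a := (x, y, z)) ⟨hx, hy, hz⟩
  have h1 := minimizer_step hp hq hr ha hb (fun x hx => hmin x b c hx hb hc)
    fun y hy => hmin a y c ha hy hc
  have h2 : ((p : ℝ) + 1) * C ≤ (p + 1) * gaussMoment p q r a b c :=
    mul_le_mul_of_nonneg_left (h a b c ha hb hc) (by positivity)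
  exact (h2.trans h1).trans (hmin u v w hu hv hw)

/-- Vectors attaining the bound minimize the moment, so they also attain the bound for the exponent
lowered by two. -/
theorem IsMomentBound.eq_of_add_two {p q r : ℕ} {C : ℝ} (hp : Even p) (hq : Even q) (hr : Even r)
    (h : IsMomentBound ι p q r C) {u v w : ι → ℝ} (hu : u ⬝ᵥ u = 1) (hv : v ⬝ᵥ v = 1)
    (hw : w ⬝ᵥ w = 1) (heq : gaussMoment (p + 2) q r u v w = (p + 1) * C) :
    gaussMoment p q r u v w = C := by
  have hb := h.add_two hp hq hr
  have h1 := minimizer_step hp hq hr hu hv (fun x hx => heq ▸ hb x v w hx hv hw)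
    fun y hy => heq ▸ hb u y w hu hy hw
  rw [heq] at h1
  exact le_antisymm (le_of_mul_le_mul_left h1 (by positivity)) (h u v w hu hv hw)

theorem IsMomentBound.swap₁₂ {p q r : ℕ} {C : ℝ} (h : IsMomentBound ι p q r C) :
    IsMomentBound ι q p r C := fun u v w hu hv hw => by
  rw [gaussMoment_swap₁₂]; exact h v u w hv hu hw

/-- The moment of order `2 * k` of a standard Gaussian variable, `1 * 3 * ⋯ * (2 * k - 1)`. -/
def evenMoment (k : ℕ) : ℝ := ∏ j ∈ Finset.range k, (2 * (j : ℝ) + 1)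

theorem evenMoment_zero : evenMoment 0 = 1 := by simp [evenMoment]

theorem evenMoment_succ (k : ℕ) : evenMoment (k + 1) = (2 * k + 1) * evenMoment k := by
  rw [evenMoment, Finset.prod_range_succ, mul_comm]; rfl

theorem gaussMoment_single {u : ι → ℝ} (hu : u ⬝ᵥ u = 1) (k : ℕ) (v w : ι → ℝ) :
    gaussMoment (2 * k) 0 0 u v w = evenMoment k := by
  induction k with
  | zero => rw [mul_zero, gaussMoment_zero, evenMoment_zero]
  | succ k ih =>
    rw [show 2 * (k + 1) = 2 * k + 1 + 1 by ring, gaussMoment_succ, evenMoment_succ, hu,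
      Nat.add_sub_cancel, ih]
    push_cast; ring

theorem isMomentBound_even (i j k : ℕ) :
    IsMomentBound ι (2 * i) (2 * j) (2 * k) (evenMoment i * evenMoment j * evenMoment k) := by
  induction i with
  | succ i ih =>
    have := ih.add_two (even_two_mul i) (even_two_mul j) (even_two_mul k)
    rw [evenMoment_succ, show 2 * (i + 1) = 2 * i + 2 by ring]
    convert this using 1
    push_cast; ring
  | zero =>
    induction j with
    | succ j ih =>
      have := (ih.swap₁₂.add_two (even_two_mul j) (even_two_mul 0) (even_two_mul k)).swap₁₂
      rw [evenMoment_succ, show 2 * (j + 1) = 2 * j + 2 by ring]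
      convert this using 1
      push_cast; ring
    | zero =>
      intro u v w _ _ hw
      rw [mul_zero, gaussMoment_swap₁₃, gaussMoment_single hw]
      simp [evenMoment_zero]

/-- The vectors `u, v, w` attain the bound of `isMomentBound_even`: the mixed moment of exponents
`2 * i, 2 * j, 2 * k` is the product of the moments. -/
def IsMomentEq (i j k : ℕ) (u v w : ι → ℝ) : Prop :=
  gaussMoment (2 * i) (2 * j) (2 * k) u v w = evenMoment i * evenMoment j * evenMoment k

theorem IsMomentEq.swap₁₂ {i j k : ℕ} {u v w : ι → ℝ} (h : IsMomentEq i j k u v w) :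
    IsMomentEq j i k v u w := by
  rw [IsMomentEq, gaussMoment_swap₁₂, h]; ring

theorem IsMomentEq.swap₁₃ {i j k : ℕ} {u v w : ι → ℝ} (h : IsMomentEq i j k u v w) :
    IsMomentEq k j i w v u := by
  rw [IsMomentEq, gaussMoment_swap₁₃, h]; ring

/-- Equality passes to smaller exponents. -/
theorem IsMomentEq.of_le {i i' j k : ℕ} (hi : i' ≤ i) {u v w : ι → ℝ} (hu : u ⬝ᵥ u = 1)
    (hv : v ⬝ᵥ v = 1) (hw : w ⬝ᵥ w = 1) (h : IsMomentEq i j k u v w) : IsMomentEq i' j k u v w := by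
  induction i, hi using Nat.le_induction with
  | base => exact h
  | succ i _ ih =>
    refine ih ((isMomentBound_even i j k).eq_of_add_two (even_two_mul i) (even_two_mul j)
      (even_two_mul k) hu hv hw ?_)
    rw [IsMomentEq, evenMoment_succ] at h
    rw [show 2 * i + 2 = 2 * (i + 1) by ring, h]
    push_cast; ring

/-- Equality descends to the exponents `(2, 2, 0)`, where the moment is `1 + 2 * (u ⬝ᵥ v) ^ 2`. -/
theorem IsMomentEq.dotProduct_eq_zero {i j k : ℕ} (hi : i ≠ 0) (hj : j ≠ 0) {u v w : ι → ℝ}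
    (hu : u ⬝ᵥ u = 1) (hv : v ⬝ᵥ v = 1) (hw : w ⬝ᵥ w = 1) (h : IsMomentEq i j k u v w) :
    u ⬝ᵥ v = 0 := by
  have h := ((h.of_le (Nat.one_le_iff_ne_zero.2 hi) hu hv hw).swap₁₂.of_le
    (Nat.one_le_iff_ne_zero.2 hj) hv hu hw).swap₁₃.of_le (Nat.zero_le k) hw hu hv
  have h : gaussMoment (1 + 1) 2 0 u v w = 1 := by
    have := h.swap₁₃.swap₁₂
    simpa [IsMomentEq, evenMoment] using this
  have e1 : gaussMoment (1 + 1) 2 0 u v w = 1 + 2 * (u ⬝ᵥ v) * (u ⬝ᵥ v) := by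
    have s1 : gaussMoment 0 (1 + 1) 0 u v w = 1 := by
      rw [gaussMoment_swap₁₂, gaussMoment_succ]
      simp [hv, gaussMoment_zero]
    have s2 : gaussMoment (0 + 1) 1 0 u v w = u ⬝ᵥ v := by
      rw [gaussMoment_succ]; simp [gaussMoment_zero]
    rw [gaussMoment_succ, hu]
    simp at s1 s2 ⊢
    rw [s1, s2]
  rw [e1] at h
  have : (u ⬝ᵥ v) * (u ⬝ᵥ v) = 0 := by linarith
  simpa using this

/-! ### Centered Gaussian vectors as linear images of a standard Gaussian vector -/

open scoped MatrixOrder in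
/-- A centered Gaussian vector has the law of a linear image of a standard Gaussian vector. The rows
`a i` are those of the square root of the covariance matrix, which may be singular. -/
theorem ProbabilityTheory.HasGaussianLaw.exists_map_eq [DecidableEq ι] {Ω : Type*}
    [MeasurableSpace Ω] {P : Measure Ω} {X : ι → Ω → ℝ}
    (hX : HasGaussianLaw (fun ω i => X i ω) P) (hcentered : ∀ i, ∫ ω, X i ω ∂P = 0) :
    ∃ a : ι → ι → ℝ, P.map (fun ω i => X i ω) =
      (Measure.pi fun _ : ι => gaussianReal 0 1).map fun x i => a i ⬝ᵥ x := by
  have hP := hX.isProbabilityMeasure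
  have hXi (i : ι) : HasGaussianLaw (X i) P := hX.eval i
  have hL2 (i : ι) : MemLp (X i) 2 P := (hXi i).memLp_two
  let Y : Ω → EuclideanSpace ℝ ι := fun ω => WithLp.toLp 2 (X · ω)
  have hY : HasGaussianLaw Y P := hX.map_equiv_fun (PiLp.continuousLinearEquiv 2 ℝ _).symm
  have hYm : AEMeasurable Y P := hY.aemeasurable
  have := hY.isGaussian_map
  let S : Matrix ι ι ℝ := Matrix.of fun i j => cov[X i, X j; P]
  have hquad (x y : EuclideanSpace ℝ ι) : covarianceBilin (P.map Y) x y = x ⬝ᵥ S *ᵥ y := by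
    rw [covarianceBilin_apply_pi hL2]
    simp only [dotProduct, mulVec, Finset.mul_sum, S, Matrix.of_apply]
    exact Finset.sum_congr rfl fun i _ => Finset.sum_congr rfl fun j _ => by ring
  have hS : S.PosSemidef := by
    refine PosSemidef.of_dotProduct_mulVec_nonneg ?_ fun x => ?_
    · ext i j; simp [S, covariance_comm]
    · have h := isPosSemidef_covarianceBilin (μ := P.map Y) |>.nonneg (WithLp.toLp 2 x)
      rw [ContinuousLinearMap.toBilinForm_apply, hquad] at h
      simpa using h
  have hlaw : P.map Y = multivariateGaussian 0 S := by
    apply IsGaussian.ext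
    · rw [integral_id_multivariateGaussian', integral_map hYm (by fun_prop)]
      ext i
      have := ContinuousLinearMap.integral_comp_comm (EuclideanSpace.proj (𝕜 := ℝ) i) hY.integrable
      simp only [id_eq]
      refine this.symm.trans ?_
      simpa [Y] using hcentered i
    · ext x y
      rw [covarianceBilin_multivariateGaussian hS, hquad]
  refine ⟨fun i j => CFC.sqrt S i j, ?_⟩
  have e1 : P.map (fun ω i => X i ω) = (P.map Y).map (WithLp.ofLp) := by
    rw [AEMeasurable.map_map_of_aemeasurable (by fun_prop) hYm]; rfl
  rw [e1, hlaw, multivariateGaussian, ← map_pi_eq_stdGaussian, Measure.map_map (by fun_prop)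
    (by fun_prop), Measure.map_map (by fun_prop) (by fun_prop)]
  congr 1
  ext x i
  simp [mulVec]

end

/-! ### The three-dimensional product inequality for even exponents -/

/-- The three-dimensional Gaussian product inequality, with its equality case, for arbitrary
positive even exponents. -/
theorem gaussian_product_inequality_three {Ω : Type*} [MeasurableSpace Ω] {P : Measure Ω}
    {X : Fin 3 → Ω → ℝ}
    (hX : HasGaussianLaw (fun ω i => X i ω) P) (hcentered : ∀ i, ∫ ω, X i ω ∂P = 0)
    (hvar : ∀ i, 0 < Var[X i; P]) (i j k : ℕ) (hi : i ≠ 0) (hj : j ≠ 0) (hk : k ≠ 0) :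
    (∫ ω, X 0 ω ^ (2 * i) ∂P) * (∫ ω, X 1 ω ^ (2 * j) ∂P) * (∫ ω, X 2 ω ^ (2 * k) ∂P) ≤
        ∫ ω, X 0 ω ^ (2 * i) * X 1 ω ^ (2 * j) * X 2 ω ^ (2 * k) ∂P ∧
      (∫ ω, X 0 ω ^ (2 * i) * X 1 ω ^ (2 * j) * X 2 ω ^ (2 * k) ∂P =
        (∫ ω, X 0 ω ^ (2 * i) ∂P) * (∫ ω, X 1 ω ^ (2 * j) ∂P) * (∫ ω, X 2 ω ^ (2 * k) ∂P) ↔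
        iIndepFun X P) := by
  have hP := hX.isProbabilityMeasure
  have hXi (i : Fin 3) : HasGaussianLaw (X i) P := hX.eval i
  have hL2 (i : Fin 3) : MemLp (X i) 2 P := (hXi i).memLp_two
  obtain ⟨a, ha⟩ := hX.exists_map_eq hcentered
  have hXm : AEMeasurable (fun ω i => X i ω) P := hX.aemeasurable
  have hmom (l m n : Fin 3) (p q r : ℕ) : ∫ ω, X l ω ^ p * X m ω ^ q * X n ω ^ r ∂P =
      gaussMoment p q r (a l) (a m) (a n) := by
    have hf : Measurable fun x : Fin 3 → ℝ => x l ^ p * x m ^ q * x n ^ r := by fun_prop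
    have ham : Measurable fun (x : Fin 3 → ℝ) i => a i ⬝ᵥ x := by
      unfold dotProduct; fun_prop
    rw [gaussMoment_eq_integral]
    rw [← integral_map (f := fun x : Fin 3 → ℝ => x l ^ p * x m ^ q * x n ^ r) hXm
      hf.aestronglyMeasurable, ha, integral_map ham.aemeasurable hf.aestronglyMeasurable]
  have hmom1 (l : Fin 3) (p : ℕ) : ∫ ω, X l ω ^ p ∂P = gaussMoment p 0 0 (a l) (a l) (a l) := by
    rw [← hmom]; simp
  have hcov (l m : Fin 3) : cov[X l, X m; P] = a l ⬝ᵥ a m := by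
    have := hmom l m m 1 1 0
    rw [covariance_eq_sub (hL2 l) (hL2 m), hcentered, hcentered]
    simp only [pow_one, pow_zero, mul_one] at this
    simp only [Pi.mul_apply, this, gaussMoment_succ 0]
    simp [gaussMoment_zero]
  have hpos (l : Fin 3) : 0 < a l ⬝ᵥ a l := by
    rw [← hcov, covariance_self (hXi l).aemeasurable]; exact hvar l
  -- normalize the rows to unit vectors
  let s : Fin 3 → ℝ := fun l => Real.sqrt (a l ⬝ᵥ a l)
  have hs (l : Fin 3) : 0 < s l := Real.sqrt_pos.2 (hpos l)
  let u : Fin 3 → Fin 3 → ℝ := fun l => (s l)⁻¹ • a l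
  have hau (l : Fin 3) : a l = s l • u l := by simp [u, smul_smul, (hs l).ne']
  have hu (l : Fin 3) : u l ⬝ᵥ u l = 1 := by
    have : s l ^ 2 = a l ⬝ᵥ a l := Real.sq_sqrt (hpos l).le
    simp only [u, smul_dotProduct, dotProduct_smul, smul_eq_mul, ← this]
    have := (hs l).ne'
    field_simp
  have hJ : ∫ ω, X 0 ω ^ (2 * i) * X 1 ω ^ (2 * j) * X 2 ω ^ (2 * k) ∂P =
      s 0 ^ (2 * i) * s 1 ^ (2 * j) * s 2 ^ (2 * k) *
        gaussMoment (2 * i) (2 * j) (2 * k) (u 0) (u 1) (u 2) := by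
    rw [hmom, hau 0, hau 1, hau 2, gaussMoment_smul, gaussMoment_swap₁₂, gaussMoment_smul,
      gaussMoment_swap₁₃, gaussMoment_smul, gaussMoment_swap₁₃, gaussMoment_swap₁₂]
    ring
  have hI (l : Fin 3) (n : ℕ) : ∫ ω, X l ω ^ (2 * n) ∂P = s l ^ (2 * n) * evenMoment n := by
    rw [hmom1, ← gaussMoment_single (hu l) n (a l) (a l), ← gaussMoment_smul, ← hau]
  set c := s 0 ^ (2 * i) * s 1 ^ (2 * j) * s 2 ^ (2 * k) with hc
  have hcpos : 0 < c := by have := hs 0; have := hs 1; have := hs 2; positivity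
  have hprod : (∫ ω, X 0 ω ^ (2 * i) ∂P) * (∫ ω, X 1 ω ^ (2 * j) ∂P) *
      (∫ ω, X 2 ω ^ (2 * k) ∂P) = c * (evenMoment i * evenMoment j * evenMoment k) := by
    rw [hI, hI, hI]; ring
  refine ⟨?_, fun h => ?_, fun h => ?_⟩
  · rw [hprod, hJ]
    exact mul_le_mul_of_nonneg_left (isMomentBound_even i j k _ _ _ (hu 0) (hu 1) (hu 2)) hcpos.le
  · rw [hprod, hJ] at h
    have h : IsMomentEq i j k (u 0) (u 1) (u 2) := mul_left_cancel₀ hcpos.ne' h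
    have h01 := h.dotProduct_eq_zero hi hj (hu 0) (hu 1) (hu 2)
    have h12 := h.swap₁₂.swap₁₃.dotProduct_eq_zero hk hi (hu 2) (hu 0) (hu 1)
    have h21 := h.swap₁₃.dotProduct_eq_zero hk hj (hu 2) (hu 1) (hu 0)
    refine hX.iIndepFun_of_covariance_eq_zero fun l m hlm => ?_
    rw [hcov, hau l, hau m, smul_dotProduct, dotProduct_smul]
    have : u l ⬝ᵥ u m = 0 := by
      fin_cases l <;> fin_cases m <;> first | exact absurd rfl hlm | assumption |
        (rw [dotProduct_comm]; assumption)
    simp [this]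
  · have := h.integral_fun_prod_comp (fun l => (hXi l).aemeasurable)
      (f := fun l (x : ℝ) => x ^ (2 * ![i, j, k] l))
      fun l => Measurable.aestronglyMeasurable (by fun_prop)
    simpa [Fin.prod_univ_three] using this

/-- `X 0, X 1, X 2` stand for `X₁, X₂, X₃`. -/
theorem theorem4p1 {Ω : Type*} [MeasurableSpace Ω] (P : MeasureTheory.Measure Ω)
    (m : ℕ) (hm : 1 ≤ m) (X : Fin 3 → Ω → ℝ)
    (hX : ProbabilityTheory.HasGaussianLaw (fun ω i => X i ω) P)
    (hcentered : ∀ i, ∫ ω, X i ω ∂P = 0)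
    (hvar : ∀ i, 0 < ProbabilityTheory.variance (X i) P) :
    (∫ ω, X 0 ω ^ (2 * m) ∂P) * (∫ ω, X 1 ω ^ 6 ∂P) * (∫ ω, X 2 ω ^ 4 ∂P) ≤
        ∫ ω, X 0 ω ^ (2 * m) * X 1 ω ^ 6 * X 2 ω ^ 4 ∂P ∧
      (∫ ω, X 0 ω ^ (2 * m) * X 1 ω ^ 6 * X 2 ω ^ 4 ∂P =
          (∫ ω, X 0 ω ^ (2 * m) ∂P) * (∫ ω, X 1 ω ^ 6 ∂P) * (∫ ω, X 2 ω ^ 4 ∂P) ↔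
        ProbabilityTheory.iIndepFun X P) :=
  gaussian_product_inequality_three hX hcentered hvar m 3 2 (by omega) (by norm_num) (by norm_num)
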